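/- For $\lambda\ge 2$ put $D=\lambda^{1/12}$, \[ Q_\lambda=\bigl\{(t,x)\in\mathbb R\times\mathbb R^3:\ |t|\le\tfrac12\lambda^{-3/2},\ |x|\le\tfrac12\lambda^{-1/2}\bigr\}, \qquad S_\lambda(t,x)=(\lambda^{3/2}t,\ \lambda^{1/2}x), \] and, for $z\in\mathbb R^4=\mathbb R\times\mathbb R^3$ and $Z\subset\mathbb R^4$, let $\operatorname{dist}_\lambda(z,Z)=\operatorname{dist}(S_\lambda z,S_\lambda Z)$ be the Euclidean distance from the point $S_\lambda z$ to the set $S_\lambda Z$ (equal to $+\infty$ if $Z=\emptyset$). For a real polynomial $P$ on $\mathbb R^4$ let $Z(P)=\{z\in\mathbb R^4: P(z)=0\}$. **Lemma.** For every constant $c>0$ there is a constant $C>0$, depending only on $c$, such that for every $\lambda\ge 2$ and every real polynomial $P$ on $\mathbb R^4$ of total degree $d$ with $1\le d\le D^{1/4}$, the following holds. Set \[ \beta=\frac{c\,D^{-1}}{d},\qquad \mathcal N_\beta(P)=\bigl\{z\in Q_\lambda:\ \operatorname{dist}_\lambda(z,Z(P))<\beta\bigr\}. \] Then \[ |Q_\lambda\cap\mathcal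 N_\beta(P)|\ \le\ C\,D^{-1}\,|Q_\lambda|, \] where $|\cdot|$ denotes Lebesgue measure on $\mathbb R^4$. -/

import Mathlib

open MeasureTheory
open scoped ENNReal

namespace Shell

/-- Space-time `ℝ_t × ℝ³_x` as Euclidean `ℝ⁴`: coordinate `0` is the time `t`,
coordinates `1, 2, 3` are the space variable `x`. -/
abbrev SpaceTime : Type := EuclideanSpace ℝ (Fin 4)

/-- The space component `x` of a point `(t, x)`. -/
noncomputable def spacePart (z : SpaceTime) : EuclideanSpace ℝ (Fin 3) :=
  !₂[z 1, z 2, z 3]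

/-- The parameter `D = λ^{1/12}`. -/
noncomputable def bigD (lam : ℝ) : ℝ := lam ^ (1 / 12 : ℝ)

/-- The cylinder `Q_λ = {(t,x) : |t| ≤ λ^{-3/2}/2, |x| ≤ λ^{-1/2}/2}`. -/
noncomputable def cylinder (lam : ℝ) : Set SpaceTime :=
  {z | |z 0| ≤ 1 / 2 * lam ^ (-(3 / 2) : ℝ) ∧
    ‖spacePart z‖ ≤ 1 / 2 * lam ^ (-(1 / 2) : ℝ)}

/-- The anisotropic scaling `S_λ(t,x) = (λ^{3/2} t, λ^{1/2} x)`. -/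
noncomputable def scaling (lam : ℝ) (z : SpaceTime) : SpaceTime :=
  !₂[lam ^ (3 / 2 : ℝ) * z 0, lam ^ (1 / 2 : ℝ) * z 1,
    lam ^ (1 / 2 : ℝ) * z 2, lam ^ (1 / 2 : ℝ) * z 3]

/-- The real zero set `Z(P)`. -/
def zeroSet (P : MvPolynomial (Fin 4) ℝ) : Set SpaceTime :=
  {z | MvPolynomial.eval (fun i => z i) P = 0}

/-- `dist_λ(z, Z) = dist(S_λ z, S_λ Z)`, the Euclidean distance from a point to a set;
it is extended-real valued, so that the distance to the empty set is `∞`. -/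
noncomputable def anisoDist (lam : ℝ) (z : SpaceTime) (Z : Set SpaceTime) : ℝ≥0∞ :=
  Metric.infEDist (scaling lam z) (scaling lam '' Z)

/-- The thickness `β = c D⁻¹ / d`, with `d = deg P` the total degree. -/
noncomputable def thickness (c lam : ℝ) (P : MvPolynomial (Fin 4) ℝ) : ℝ :=
  c * (bigD lam)⁻¹ / (P.totalDegree : ℝ)

/-- The anisotropic neighbourhood `N_β(P) = {z ∈ Q_λ : dist_λ(z, Z(P)) < β}`. -/
noncomputable def shell (lam β : ℝ) (P : MvPolynomial (Fin 4) ℝ) : Set SpaceTime :=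
  {z ∈ cylinder lam | anisoDist lam z (zeroSet P) < ENNReal.ofReal β}

end Shell

/-! After rescaling, the neighbourhood is covered by tripled cubes of side `β`, one for each grid
cube meeting the zero set. With `R ~ 1/β` cells per direction, it suffices that `O(d R³)` cubes meet
the zero set: their total volume is `O(d R³ β⁴) = O(dβ) = O(D⁻¹)`, with constants depending on `c`.

For the count, each such cube has a face of least dimension `k` containing a zero, and all zeros on
that face are interior to it (`exists_zerosInFaceInterior`). A generic translate of the grid
excludes `k = 0`. Fixing the other `4 - k` coordinates reduces the count to unit `k`-cubes with
zeros only in the interior (`card_le_of_forall_zero_mem_interior`). In each of them `p² - l·x` has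
an interior minimum for small positive `l`, so `∇(p²) = l` has a solution there. Each coordinate is
algebraic over the components of `∇(p²)`, with degree bounded by dimension counting
(`exists_polynomial_relation`), so for generic `l` there are `O(d^(k²))` such cubes.

The sum of `d^(k²) R^(4-k)` is `O(d R³)`: `k = 1` is already linear in `d`, and for `k ≥ 2` the loss
is absorbed by `d⁵ ≲ R`, which follows from `d⁴ ≤ D` and `R ≳ dD`. -/

/-! ### Polynomial preliminaries -/

open MvPolynomial in
theorem exists_forall_eval_ne_zero {σ ι : Type*} (s : Finset ι) (p : ι → MvPolynomial σ ℝ)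
    (hp : ∀ j ∈ s, p j ≠ 0) (S : σ → Set ℝ) (hS : ∀ i, (S i).Infinite) :
    ∃ x : σ → ℝ, (∀ i, x i ∈ S i) ∧ ∀ j ∈ s, eval x (p j) ≠ 0 := by
  by_contra! h
  have h0 : ∏ j ∈ s, p j = 0 := by
    refine funext_set S hS fun x hx => ?_
    obtain ⟨j, hj, hj0⟩ := h x fun i => hx i (Set.mem_univ i)
    rw [map_prod, map_zero]
    exact Finset.prod_eq_zero hj hj0
  obtain ⟨j, hj, hj0⟩ := Finset.prod_eq_zero_iff.1 h0
  exact hp j hj hj0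

open MvPolynomial in
theorem totalDegree_aeval_le_of_le_one {σ τ : Type*} (p : MvPolynomial σ ℝ)
    (g : σ → MvPolynomial τ ℝ) (hg : ∀ i, (g i).totalDegree ≤ 1) :
    (aeval g p).totalDegree ≤ p.totalDegree := by
  rw [aeval_def, eval₂_eq]
  refine totalDegree_finsetSum_le fun b hb => ?_
  refine (totalDegree_mul _ _).trans ?_
  rw [algebraMap_eq, totalDegree_C, zero_add]
  refine (totalDegree_finsetProd _ _).trans ?_
  refine le_trans (Finset.sum_le_sum fun i _ => ?_) (le_totalDegree hb)
  exact (totalDegree_pow _ _).trans (by simpa using Nat.mul_le_mul_left (b i) (hg i))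

open MvPolynomial in
theorem totalDegree_pderiv_le {σ : Type*} (p : MvPolynomial σ ℝ) (j : σ) :
    (pderiv j p).totalDegree ≤ p.totalDegree := by
  classical
  conv_lhs => rw [p.as_sum, map_sum]
  refine totalDegree_finsetSum_le fun b hb => ?_
  rw [pderiv_monomial]
  refine (totalDegree_monomial_le _ _).trans (le_trans ?_ (le_totalDegree hb))
  exact Finsupp.degree_mono tsub_le_self

open MvPolynomial in
theorem hasDerivAt_eval_update {σ : Type*} [DecidableEq σ] (p : MvPolynomial σ ℝ) (x : σ → ℝ)
    (j : σ) (t : ℝ) :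
    HasDerivAt (fun s => eval (Function.update x j s) p)
      (eval (Function.update x j t) (pderiv j p)) t := by
  induction p using MvPolynomial.induction_on with
  | C a => simpa using hasDerivAt_const t a
  | add p q hp hq => simpa using! hp.fun_add hq
  | mul_X p i hp =>
    have hX : HasDerivAt (fun s => eval (Function.update x j s) (X i : MvPolynomial σ ℝ))
        (eval (Function.update x j t) (pderiv j (X i))) t := by
      by_cases h : i = j
      · subst h
        simpa using hasDerivAt_id' t
      · simpa [h, pderiv_X_of_ne (R := ℝ) h] using hasDerivAt_const t (x i)
    simp only [map_mul]
    refine (hp.fun_mul hX).congr_deriv ?_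
    simp only [Derivation.leibniz, smul_eq_mul, map_add, map_mul]
    ring

/-! ### Algebraic relations by dimension counting -/

open MvPolynomial in
/-- A coordinate function is a root of a polynomial of degree at most `(k e + 1) ^ k` whose
coefficients are polynomials in `k` given functions of degree at most `e`. -/
theorem exists_polynomial_relation {σ : Type*} [Fintype σ] [DecidableEq σ] (e : ℕ)
    (f : σ → MvPolynomial σ ℝ) (hf : ∀ j, (f j).totalDegree ≤ e) (i : σ) :
    ∃ G : Polynomial (MvPolynomial σ ℝ), G ≠ 0 ∧
      G.natDegree ≤ (Fintype.card σ * e + 1) ^ Fintype.card σ ∧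
      ∀ x : σ → ℝ, (G.map (eval fun j => eval x (f j))).eval (x i) = 0 := by
  set k := Fintype.card σ
  -- There are `(A + 1)^(k + 1)` products `x_i^a ∏ f_j^(b_j)` with exponents at most `A`, all of
  -- degree at most `N`. This `A` makes `(N + 1)^k ≤ A (A + 1)^k`, so they are linearly dependent.
  set A := (k * e + 1) ^ k with hA
  set N := A + k * e * A with hN
  let Φ : (Fin (A + 1) × (σ → Fin (A + 1)) → ℝ) →ₗ[ℝ] MvPolynomial σ ℝ :=
    Fintype.linearCombination ℝ
      fun ab : Fin (A + 1) × (σ → Fin (A + 1)) =>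
        (X i ^ (ab.1 : ℕ) * ∏ j, f j ^ (ab.2 j : ℕ) : MvPolynomial σ ℝ)
  have hdeg : ∀ c, (Φ c).totalDegree ≤ N := by
    intro c
    refine totalDegree_finsetSum_le fun ab _ => (totalDegree_smul_le _ _).trans ?_
    refine (totalDegree_mul _ _).trans ?_
    refine add_le_add ((totalDegree_X_pow _ _).le.trans (by have := ab.1.2; omega)) ?_
    refine (totalDegree_finsetProd _ _).trans ?_
    calc ∑ j, (f j ^ (ab.2 j : ℕ)).totalDegree ≤ ∑ _j : σ, A * e :=
          Finset.sum_le_sum fun j _ => (totalDegree_pow _ _).trans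
            (Nat.mul_le_mul (by have := (ab.2 j).2; omega) (hf j))
      _ = k * e * A := by simp [k]; ring
  let Ψ : MvPolynomial σ ℝ →ₗ[ℝ] ((σ → Fin (N + 1)) → ℝ) :=
    LinearMap.pi fun b => lcoeff ℝ (Finsupp.equivFunOnFinite.symm fun j => (b j : ℕ))
  have hcard : Module.finrank ℝ ((σ → Fin (N + 1)) → ℝ) <
      Module.finrank ℝ (Fin (A + 1) × (σ → Fin (A + 1)) → ℝ) := by
    simp only [Module.finrank_fintype_fun_eq_card, Fintype.card_prod, Fintype.card_fun,
      Fintype.card_fin]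
    have h1 : N + 1 ≤ (k * e + 1) * (A + 1) := by rw [hN]; nlinarith
    calc (N + 1) ^ k ≤ ((k * e + 1) * (A + 1)) ^ k := Nat.pow_le_pow_left h1 k
      _ = A * (A + 1) ^ k := by rw [mul_pow]
      _ < (A + 1) * (A + 1) ^ k := Nat.mul_lt_mul_of_pos_right (Nat.lt_succ_self A) (by positivity)
  obtain ⟨c, hcker, hc⟩ :=
    (Submodule.ne_bot_iff _).1 (LinearMap.ker_ne_bot_of_finrank_lt (f := Ψ ∘ₗ Φ) hcard)
  have hΦ : Φ c = 0 := by
    ext b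
    by_cases hb : ∀ j, b j < N + 1
    · have := congrFun (LinearMap.mem_ker.1 hcker) fun j => ⟨b j, hb j⟩
      have hbb : (Finsupp.equivFunOnFinite.symm fun j => b j) = b := by ext; simp
      simpa [Ψ, hbb] using this
    · push Not at hb
      obtain ⟨j, hj⟩ := hb
      rw [coeff_zero]
      refine coeff_eq_zero_of_totalDegree_lt (lt_of_le_of_lt (hdeg c) ?_)
      refine lt_of_lt_of_le hj ?_
      by_cases hjs : j ∈ b.support
      · exact Finset.single_le_sum (f := fun i => b i) (fun _ _ => Nat.zero_le _) hjs
      · rw [Finsupp.notMem_support_iff.1 hjs]; exact Nat.zero_le _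
  let E : (σ → Fin (A + 1)) → σ →₀ ℕ := fun b => Finsupp.equivFunOnFinite.symm fun j => (b j : ℕ)
  have hE : Function.Injective E := by
    intro b b' h
    funext j
    exact Fin.ext (by simpa [E] using DFunLike.congr_fun h j)
  refine ⟨∑ ab, Polynomial.monomial (ab.1 : ℕ) (monomial (E ab.2) (c ab)), ?_, ?_, ?_⟩
  · intro hG
    refine hc (funext fun ab => ?_)
    have h := congrArg (fun G => coeff (E ab.2) (Polynomial.coeff G (ab.1 : ℕ))) hG
    simp only [Polynomial.finsetSum_coeff, coeff_sum, Polynomial.coeff_monomial] at h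
    rw [Finset.sum_eq_single ab] at h
    · simpa using h
    · rintro ⟨a', b'⟩ - hne
      by_cases h1 : (a' : ℕ) = (ab.1 : ℕ)
      · rw [if_pos h1, coeff_monomial, if_neg]
        intro h2
        exact hne (Prod.ext (Fin.ext h1) (hE h2))
      · simp [if_neg h1]
    · simp
  · refine Polynomial.natDegree_sum_le_of_forall_le _ _ fun ab _ => ?_
    exact (Polynomial.natDegree_monomial_le _).trans (by have := ab.1.2; omega)
  · intro x
    have h := congrArg (eval x) hΦ
    simp only [Φ, Fintype.linearCombination_apply, map_sum, smul_eval, map_mul, map_pow, eval_X,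
      map_prod, map_zero] at h
    simp only [Polynomial.map_sum, Polynomial.map_monomial, Polynomial.eval_finsetSum,
      Polynomial.eval_monomial, eval_monomial]
    rw [← h]
    refine Finset.sum_congr rfl fun ab _ => ?_
    rw [Finsupp.prod_fintype _ _ (fun _ => pow_zero _)]
    simp only [E, Finsupp.equivFunOnFinite_symm_apply_apply]
    ring

/-! ### Cubes whose zeros are all interior -/

open MvPolynomial in
theorem eval_pderiv_eq_of_isLocalMin {σ : Type*} [Fintype σ] [DecidableEq σ]
    (f : MvPolynomial σ ℝ) (l x : σ → ℝ)
    (hx : IsLocalMin (fun y : σ → ℝ => eval y f - ∑ i, l i * y i) x) (j : σ) :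
    eval x (pderiv j f) = l j := by
  have hc : ContinuousAt (fun t : ℝ => Function.update x j t) (x j) :=
    (continuous_const.update j continuous_id).continuousAt
  have hmin : IsLocalMin (fun t : ℝ => eval (Function.update x j t)
      (f - ∑ i, C (l i) * X i)) (x j) := by
    have := hc.tendsto
    rw [Function.update_eq_self] at this
    filter_upwards [this.eventually hx] with t ht
    simpa using ht
  have h := hmin.hasDerivAt_eq_zero (hasDerivAt_eval_update _ x j (x j))
  rw [Function.update_eq_self] at h
  simp only [map_sub, map_sum, Derivation.leibniz, derivation_C, smul_eq_mul, mul_zero,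
    add_zero, pderiv_X, map_mul, eval_C] at h
  simp [Pi.single_apply, apply_ite] at h
  linarith

open MvPolynomial in
/-- A zero of `p` in a unit cube with no zeros on the boundary forces the gradient of `p ^ 2` to
take all small values with positive coordinates inside the cube. -/
theorem exists_eval_pderiv_sq_eq {σ : Type*} [Fintype σ] [DecidableEq σ]
    (p : MvPolynomial σ ℝ) (m : σ → ℤ)
    (h₁ : ∃ x : σ → ℝ, (∀ i, (m i : ℝ) ≤ x i ∧ x i ≤ m i + 1) ∧ eval x p = 0)
    (h₂ : ∀ x : σ → ℝ, (∀ i, (m i : ℝ) ≤ x i ∧ x i ≤ m i + 1) → eval x p = 0 →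
      ∀ i, (m i : ℝ) < x i ∧ x i < m i + 1) :
    ∃ δ : ℝ, 0 < δ ∧ ∀ l : σ → ℝ, (∀ i, 0 < l i ∧ l i < δ) →
      ∃ x : σ → ℝ, (∀ i, (m i : ℝ) < x i ∧ x i < m i + 1) ∧
        ∀ j, eval x (pderiv j (p ^ 2)) = l j := by
  obtain ⟨z, hzK, hz⟩ := h₁
  let K : Set (σ → ℝ) := Set.pi Set.univ fun i => Set.Icc (m i : ℝ) (m i + 1)
  let U : Set (σ → ℝ) := Set.pi Set.univ fun i => Set.Ioo (m i : ℝ) (m i + 1)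
  have hK : IsCompact K := isCompact_univ_pi fun i => isCompact_Icc
  have hU : IsOpen U := isOpen_set_pi Set.finite_univ fun i _ => isOpen_Ioo
  have hUK : U ⊆ K := Set.pi_mono fun i _ => Set.Ioo_subset_Icc_self
  have hzK' : z ∈ K := fun i _ => hzK i
  have hpc : Continuous fun y : σ → ℝ => eval y (p ^ 2) := MvPolynomial.continuous_eval _
  obtain ⟨ε, hε, hεB⟩ := (hK.diff hU).exists_forall_le' (a := 0) hpc.continuousOn fun x hx => by
    rw [map_pow]
    exact sq_pos_of_ne_zero fun h0 => hx.2 fun i _ => h₂ x (fun i => hx.1 i trivial) h0 i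
  -- Here `ε` bounds `p²` from below on the boundary. Across a unit cube `l·x` varies by less than
  -- `ε`, so a boundary point cannot beat the zero `z` in minimising `p² - l·x`.
  refine ⟨ε / (Fintype.card σ + 1), by positivity, fun l hl => ?_⟩
  obtain ⟨x, hxK, hx⟩ := hK.exists_isMinOn ⟨z, hzK'⟩
    (f := fun y : σ → ℝ => eval y (p ^ 2) - ∑ i, l i * y i) (by fun_prop)
  have hxU : x ∈ U := by
    by_contra hxU
    have h1 : eval x (p ^ 2) - ∑ i, l i * x i ≤ eval z (p ^ 2) - ∑ i, l i * z i := hx hzK'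
    have h2 := hεB x ⟨hxK, hxU⟩
    have h3 : ∑ i, l i * x i - ∑ i, l i * z i ≤ ∑ _i : σ, ε / (Fintype.card σ + 1) := by
      rw [← Finset.sum_sub_distrib]
      refine Finset.sum_le_sum fun i _ => ?_
      have := hxK i trivial
      have := hzK i
      have := hl i
      simp only [Set.mem_Icc] at *
      nlinarith
    have h4 : ∑ _i : σ, ε / (Fintype.card σ + 1) < ε := by
      rw [Finset.sum_const, Finset.card_univ, nsmul_eq_mul, mul_div_assoc', div_lt_iff₀ (by positivity)]
      nlinarith
    simp only [map_pow, hz] at h1 h2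
    norm_num at h1
    linarith
  refine ⟨x, fun i => hxU i trivial, fun j => eval_pderiv_eq_of_isLocalMin _ l x ?_ j⟩
  exact hx.isLocalMin (Filter.mem_of_superset (hU.mem_nhds hxU) hUK)

open MvPolynomial in
/-- Bound for the number of unit lattice cubes which meet the zero set of `p` in their interior
but not on their boundary. -/
theorem card_le_of_forall_zero_mem_interior {σ : Type*} [Fintype σ] [DecidableEq σ]
    (p : MvPolynomial σ ℝ) (d : ℕ) (hd : p.totalDegree ≤ d) (M : Finset (σ → ℤ))
    (h₁ : ∀ m ∈ M, ∃ x : σ → ℝ, (∀ i, (m i : ℝ) ≤ x i ∧ x i ≤ m i + 1) ∧ eval x p = 0)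
    (h₂ : ∀ m ∈ M, ∀ x : σ → ℝ, (∀ i, (m i : ℝ) ≤ x i ∧ x i ≤ m i + 1) → eval x p = 0 →
      ∀ i, (m i : ℝ) < x i ∧ x i < m i + 1) :
    M.card ≤ ((Fintype.card σ * (2 * d) + 1) ^ Fintype.card σ) ^ Fintype.card σ := by
  have hdeg : ∀ j, (pderiv j (p ^ 2)).totalDegree ≤ 2 * d := fun j =>
    (totalDegree_pderiv_le _ _).trans ((totalDegree_pow _ _).trans (Nat.mul_le_mul_left 2 hd))
  choose G hG0 hGdeg hG using exists_polynomial_relation (2 * d) _ hdeg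
  have hδ : ∃ δ : ℝ, 0 < δ ∧ ∀ m ∈ M, ∀ l : σ → ℝ, (∀ i, 0 < l i ∧ l i < δ) →
      ∃ x : σ → ℝ, (∀ i, (m i : ℝ) < x i ∧ x i < m i + 1) ∧
        ∀ j, eval x (pderiv j (p ^ 2)) = l j := by
    have H : ∀ m ∈ M, ∀ᶠ δ in nhdsWithin (0 : ℝ) (Set.Ioi 0), ∀ l : σ → ℝ,
        (∀ i, 0 < l i ∧ l i < δ) → ∃ x : σ → ℝ, (∀ i, (m i : ℝ) < x i ∧ x i < m i + 1) ∧
        ∀ j, eval x (pderiv j (p ^ 2)) = l j := by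
      intro m hm
      obtain ⟨δ, hδ, h⟩ := exists_eval_pderiv_sq_eq p m (h₁ m hm) (h₂ m hm)
      filter_upwards [Ioo_mem_nhdsGT hδ] with δ' hδ' l hl
      exact h l fun i => ⟨(hl i).1, (hl i).2.trans hδ'.2⟩
    obtain ⟨δ, h, hδ⟩ := ((M.eventually_all.2 H).and self_mem_nhdsWithin).exists
    exact ⟨δ, hδ, h⟩
  obtain ⟨δ, hδ, hM⟩ := hδ
  -- Avoiding the zeros of the leading coefficients keeps every relation `G i` nontrivial after
  -- specialisation at `l`.
  obtain ⟨l, hl, hl0⟩ := exists_forall_eval_ne_zero Finset.univ (fun i => (G i).leadingCoeff)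
    (fun i _ => Polynomial.leadingCoeff_ne_zero.2 (hG0 i)) (fun _ => Set.Ioo 0 δ)
    fun _ => Set.Ioo_infinite hδ
  -- A cube is recovered from the floors of the coordinates of its interior solution, and each
  -- coordinate is a root of a specialised `G i`.
  let T : σ → Finset ℤ := fun i => ((G i).map (eval l)).roots.toFinset.image Int.floor
  have hT : ∀ i, (T i).card ≤ (Fintype.card σ * (2 * d) + 1) ^ Fintype.card σ := fun i =>
    Finset.card_image_le.trans <| (Multiset.toFinset_card_le _).trans <|
      (Polynomial.card_roots' _).trans <| Polynomial.natDegree_map_le.trans (hGdeg i)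
  have hsub : M ⊆ Fintype.piFinset T := by
    intro m hm
    obtain ⟨x, hxm, hx⟩ := hM m hm l hl
    refine Fintype.mem_piFinset.2 fun i => Finset.mem_image.2 ⟨x i, ?_, ?_⟩
    · rw [Multiset.mem_toFinset, Polynomial.mem_roots']
      refine ⟨fun h0 => hl0 i (Finset.mem_univ i) ?_, ?_⟩
      · have := congrArg (fun q => Polynomial.coeff q (G i).natDegree) h0
        simpa using this
      · have := hG i x
        rwa [funext hx] at this
    · exact Int.floor_eq_iff.2 ⟨(hxm i).1.le, (hxm i).2⟩
  calc M.card ≤ _ := Finset.card_le_card hsub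
    _ = ∏ i, (T i).card := Fintype.card_piFinset T
    _ ≤ ∏ _i : σ, (Fintype.card σ * (2 * d) + 1) ^ Fintype.card σ :=
      Finset.prod_le_prod' fun i _ => hT i
    _ = _ := by simp

/-! ### Counting lattice faces and cubes -/

open MvPolynomial in
theorem eval_aeval_mvPolynomial {σ τ : Type*} (p : MvPolynomial σ ℝ) (g : σ → MvPolynomial τ ℝ)
    (x : τ → ℝ) : eval x (aeval g p) = eval (fun i => eval x (g i)) p := by
  induction p using MvPolynomial.induction_on with
  | C a => simp
  | add p q hp hq => simp only [map_add, hp, hq]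
  | mul_X p i hp => simp only [map_mul, aeval_X, eval_X, hp]

/-- `z` lies in the closed face of the unit lattice cube at `n` in the directions `J`. -/
def MemFace {σ : Type*} (J : Finset σ) (n : σ → ℤ) (z : σ → ℝ) : Prop :=
  (∀ i ∈ J, (n i : ℝ) ≤ z i ∧ z i ≤ n i + 1) ∧ ∀ i ∉ J, z i = n i

/-- The face `(J, n)` contains zeros of `p`, all of them in its relative interior. -/
def ZerosInFaceInterior {σ : Type*} (p : MvPolynomial σ ℝ) (J : Finset σ) (n : σ → ℤ) : Prop :=
  (∃ z, MemFace J n z ∧ MvPolynomial.eval z p = 0) ∧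
    ∀ z, MemFace J n z → MvPolynomial.eval z p = 0 → ∀ i ∈ J, (n i : ℝ) < z i ∧ z i < n i + 1

-- Faces are grouped by their fixed coordinates outside `J`. On each such slice `p` becomes a
-- polynomial of degree at most `d` in the `J` variables, and the faces become full-dimensional
-- cubes.
open MvPolynomial in
theorem card_faces_le {σ : Type*} [Fintype σ] [DecidableEq σ] (p : MvPolynomial σ ℝ) (d : ℕ)
    (hd : p.totalDegree ≤ d) (R : ℕ) (J : Finset σ) (M : Finset (σ → ℤ))
    (hM : ∀ n ∈ M, ∀ i, n i ∈ Finset.Icc (-R : ℤ) R) (hJ : ∀ n ∈ M, ZerosInFaceInterior p J n) :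
    M.card ≤ ((J.card * (2 * d) + 1) ^ J.card) ^ J.card *
      (2 * R + 1) ^ (Fintype.card σ - J.card) := by
  let t : Finset ({i // i ∉ J} → ℤ) := Fintype.piFinset fun _ => Finset.Icc (-R : ℤ) R
  have ht : t.card = (2 * R + 1) ^ (Fintype.card σ - J.card) := by
    have h1 : ((R : ℤ) + 1 + R).toNat = 2 * R + 1 := by omega
    have h2 : Fintype.card {i // i ∉ J} = Fintype.card σ - J.card := by
      rw [Fintype.card_subtype_compl]; simp
    rw [Fintype.card_piFinset]
    simp [h1, h2]
  rw [← ht]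
  refine Finset.card_le_mul_card_image_of_maps_to (f := fun n (i : {i // i ∉ J}) => n i)
    (t := t) (fun n hn => Fintype.mem_piFinset.2 fun i => hM n hn i.1) _ fun a _ => ?_
  let g : σ → MvPolynomial J ℝ := fun i => if h : i ∈ J then X ⟨i, h⟩ else C (a ⟨i, h⟩ : ℝ)
  have hg : ∀ i, (g i).totalDegree ≤ 1 := by
    intro i
    by_cases h : i ∈ J
    · simp [g, h]
    · simp only [g, dif_neg h, totalDegree_C, zero_le]
  have hface : ∀ n ∈ M, (fun i : {i // i ∉ J} => n i) = a → ∀ x : J → ℝ,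
      (∀ i : J, (n i : ℝ) ≤ x i ∧ x i ≤ n i + 1) → MemFace J n fun i => eval x (g i) := by
    intro n _ hna x hx
    refine ⟨fun i hi => by simpa [g, hi] using hx ⟨i, hi⟩, fun i hi => ?_⟩
    simp [g, hi, ← hna]
  have hinj : Set.InjOn (fun (n : σ → ℤ) (i : J) => n i)
      (M.filter fun n => (fun i : {i // i ∉ J} => n i) = a) := by
    intro n hn n' hn' h
    simp only [Finset.coe_filter, Set.mem_ofPred_eq] at hn hn'
    funext i
    by_cases hi : i ∈ J
    · exact congrFun h ⟨i, hi⟩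
    · exact (congrFun hn.2 ⟨i, hi⟩).trans (congrFun hn'.2 ⟨i, hi⟩).symm
  rw [← Finset.card_image_of_injOn hinj]
  have key := card_le_of_forall_zero_mem_interior (aeval g p) d
    ((totalDegree_aeval_le_of_le_one p g hg).trans hd)
    ((M.filter fun n => (fun i : {i // i ∉ J} => n i) = a).image fun n (i : J) => n i) ?_ ?_
  · simpa using key
  · intro m hm
    obtain ⟨n, hn, rfl⟩ := Finset.mem_image.1 hm
    obtain ⟨hnM, hna⟩ := Finset.mem_filter.1 hn
    obtain ⟨⟨z, hz, hz0⟩, -⟩ := hJ n hnM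
    refine ⟨fun i => z i, fun i => hz.1 i i.2, ?_⟩
    rw [eval_aeval_mvPolynomial, ← hz0]
    congr 2
    funext i
    by_cases hi : i ∈ J
    · simp [g, hi]
    · simp [g, hi, ← hna, hz.2 i hi]
  · intro m hm x hx hx0 i
    obtain ⟨n, hn, rfl⟩ := Finset.mem_image.1 hm
    obtain ⟨hnM, hna⟩ := Finset.mem_filter.1 hn
    rw [eval_aeval_mvPolynomial] at hx0
    simpa [g] using (hJ n hnM).2 _ (hface n hnM hna x hx) hx0 i i.2

open MvPolynomial in
/-- A unit lattice cube meeting the zero set of `p` has a face whose zeros are all interior. -/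
theorem exists_zerosInFaceInterior {σ : Type*} [Fintype σ] [DecidableEq σ] (p : MvPolynomial σ ℝ)
    (m : σ → ℤ) (hm : ∃ z : σ → ℝ, (∀ i, (m i : ℝ) ≤ z i ∧ z i ≤ m i + 1) ∧ eval z p = 0) :
    ∃ (J : Finset σ) (n : σ → ℤ), (∀ i, n i - m i = 0 ∨ n i - m i = 1) ∧
      ZerosInFaceInterior p J n := by
  -- Take a zero with the fewest non-integer coordinates; these are the directions of the face. A
  -- zero on the boundary of that face would have fewer.
  let N : (σ → ℝ) → Finset σ := fun z => Finset.univ.filter fun i => z i ≠ ⌊z i⌋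
  obtain ⟨z, ⟨hzm, hz0⟩, hmin⟩ := (measure fun z => (N z).card).wf.has_min
    {z : σ → ℝ | (∀ i, (m i : ℝ) ≤ z i ∧ z i ≤ m i + 1) ∧ eval z p = 0} hm
  have hfl : ∀ i, m i ≤ ⌊z i⌋ ∧ ⌊z i⌋ ≤ m i + 1 := fun i =>
    ⟨Int.le_floor.2 (hzm i).1, by
      have := (Int.floor_le (z i)).trans (hzm i).2
      exact_mod_cast this⟩
  refine ⟨N z, fun i => ⌊z i⌋, fun i => by have := hfl i; dsimp only; omega, ⟨z, ⟨fun i _ =>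
    ⟨Int.floor_le _, (Int.lt_floor_add_one _).le⟩, fun i hi => by simpa [N] using hi⟩, hz0⟩, ?_⟩
  intro w hw hw0
  have hNw : N w ⊆ N z := by
    intro i hi
    by_contra hiz
    have := hw.2 i hiz
    simp [N, this] at hi
  have hwm : ∀ i, (m i : ℝ) ≤ w i ∧ w i ≤ m i + 1 := by
    intro i
    by_cases hi : i ∈ N z
    · have h1 : ⌊z i⌋ = m i := by
        refine le_antisymm ?_ (hfl i).1
        by_contra! h
        have h2 : ⌊z i⌋ = m i + 1 := by have := hfl i; omega
        have h3 : z i = ⌊z i⌋ := by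
          refine le_antisymm ?_ (Int.floor_le _)
          rw [h2]; exact_mod_cast (hzm i).2
        simp [N] at hi
        exact hi h3
      have := hw.1 i hi
      dsimp only at this
      rwa [h1] at this
    · have h1 : z i = ⌊z i⌋ := by simpa [N] using hi
      rw [hw.2 i hi, ← h1]
      exact hzm i
  have hcard : (N z).card ≤ (N w).card := not_lt.1 (hmin w ⟨hwm, hw0⟩)
  have hEq := Finset.eq_of_subset_of_card_le hNw hcard
  intro i hi
  have hwi : w i ≠ ⌊w i⌋ := by
    rw [← hEq] at hi
    simpa [N] using hi
  refine ⟨lt_of_le_of_ne (hw.1 i hi).1 fun h => hwi ?_, lt_of_le_of_ne (hw.1 i hi).2 fun h => hwi ?_⟩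
  · rw [← h]; simp
  · rw [h]; simp

-- Each cube is charged to a face whose base point differs from its own by a vector in `{0,1}^σ`, so
-- a face is charged at most `2^(card σ)` times. The absence of zeros at lattice points rules out `J
-- = ∅`.
open MvPolynomial in
theorem card_cubes_le_sum {σ : Type*} [Fintype σ] [DecidableEq σ] (p : MvPolynomial σ ℝ) (d : ℕ)
    (hd : p.totalDegree ≤ d) (R : ℕ)
    (hp : ∀ n : σ → ℤ, (∀ i, n i ∈ Finset.Icc (-R : ℤ) R) → eval (fun i => (n i : ℝ)) p ≠ 0)
    (M : Finset (σ → ℤ)) (hM : ∀ m ∈ M, ∀ i, m i ∈ Finset.Ico (-R : ℤ) R)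
    (hz : ∀ m ∈ M, ∃ z : σ → ℝ, (∀ i, (m i : ℝ) ≤ z i ∧ z i ≤ m i + 1) ∧ eval z p = 0) :
    M.card ≤ ∑ J : Finset σ with J.Nonempty, 2 ^ Fintype.card σ *
      (((J.card * (2 * d) + 1) ^ J.card) ^ J.card *
        (2 * R + 1) ^ (Fintype.card σ - J.card)) := by
  classical
  let F : Finset σ → Finset (σ → ℤ) := fun J =>
    (Fintype.piFinset fun _ => Finset.Icc (-R : ℤ) R).filter fun n => ZerosInFaceInterior p J n
  let V : Finset (σ → ℤ) := Fintype.piFinset fun _ => {0, 1}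
  have hV : V.card = 2 ^ Fintype.card σ := by simp [V, Fintype.card_piFinset]
  have hF : ∀ J, (F J).card ≤ ((J.card * (2 * d) + 1) ^ J.card) ^ J.card *
      (2 * R + 1) ^ (Fintype.card σ - J.card) := fun J =>
    card_faces_le p d hd R J _ (fun n hn i => Fintype.mem_piFinset.1 (Finset.mem_filter.1 hn).1 i)
      fun n hn => (Finset.mem_filter.1 hn).2
  have hsub : M ⊆ (Finset.univ.filter fun J : Finset σ => J.Nonempty).biUnion fun J =>
      (V ×ˢ F J).image fun x => x.2 - x.1 := by
    intro m hm
    obtain ⟨J, n, hn, hJn⟩ := exists_zerosInFaceInterior p m (hz m hm)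
    have hnR : ∀ i, n i ∈ Finset.Icc (-R : ℤ) R := by
      intro i
      have h1 := hM m hm i
      have h2 := hn i
      simp only [Finset.mem_Ico, Finset.mem_Icc] at *
      omega
    refine Finset.mem_biUnion.2 ⟨J, ?_, Finset.mem_image.2 ⟨(n - m, n), ?_, by simp⟩⟩
    · simp only [Finset.mem_filter, Finset.mem_univ, true_and]
      by_contra hJ
      rw [Finset.not_nonempty_iff_eq_empty] at hJ
      subst hJ
      obtain ⟨⟨z, hzn, hz0⟩, -⟩ := hJn
      refine hp n hnR ?_
      rwa [← funext fun i => hzn.2 i (by simp)]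
    · refine Finset.mem_product.2 ⟨Fintype.mem_piFinset.2 fun i => ?_,
        Finset.mem_filter.2 ⟨Fintype.mem_piFinset.2 hnR, hJn⟩⟩
      simpa using hn i
  refine (Finset.card_le_card hsub).trans (Finset.card_biUnion_le.trans ?_)
  refine Finset.sum_le_sum fun J _ => Finset.card_image_le.trans ?_
  rw [Finset.card_product, hV]
  exact Nat.mul_le_mul_left _ (hF J)

/-- The key inequality is `k² ≤ 1 + 5(k - 1)` for `1 ≤ k ≤ 4`: one factor `d` is kept, and each
remaining `d⁵` is traded for `a R`. -/
theorem faceCount_le {k : ℕ} (hk1 : 1 ≤ k) (hk4 : k ≤ 4) {d R a : ℝ} (hd : 1 ≤ d) (hR : 1 ≤ R)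
    (ha : 1 ≤ a) (hdR : d ^ 5 ≤ a * R) :
    2 ^ 4 * (((k * (2 * d) + 1) ^ k) ^ k * (2 * R + 1) ^ (4 - k)) ≤
      16 * (9 ^ 16 * 27 * a ^ 3) * (d * R ^ 3) := by
  have h1 : ((k : ℝ) * (2 * d) + 1) ≤ 9 * d := by
    have : (k : ℝ) ≤ 4 := by exact_mod_cast hk4
    have := mul_le_mul_of_nonneg_right this (zero_le_one.trans hd)
    linarith
  have h2 : (((k : ℝ) * (2 * d) + 1) ^ k) ^ k ≤ 9 ^ 16 * d ^ (k * k) := by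
    rw [← pow_mul]
    calc ((k : ℝ) * (2 * d) + 1) ^ (k * k) ≤ (9 * d) ^ (k * k) := by gcongr
      _ = 9 ^ (k * k) * d ^ (k * k) := mul_pow _ _ _
      _ ≤ 9 ^ 16 * d ^ (k * k) := by
        gcongr
        · norm_num
        · nlinarith
  have h3 : d ^ (k * k) ≤ d * (a * R) ^ (k - 1) := by
    calc d ^ (k * k) ≤ d ^ (1 + 5 * (k - 1)) := by
          refine pow_le_pow_right₀ hd ?_
          interval_cases k <;> norm_num
      _ = d * (d ^ 5) ^ (k - 1) := by rw [pow_add, pow_mul, pow_one]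
      _ ≤ d * (a * R) ^ (k - 1) := by gcongr
  have h4 : (2 * R + 1) ^ (4 - k) ≤ 27 * R ^ (4 - k) := by
    calc (2 * R + 1) ^ (4 - k) ≤ (3 * R) ^ (4 - k) := by gcongr; linarith
      _ = 3 ^ (4 - k) * R ^ (4 - k) := mul_pow _ _ _
      _ ≤ 3 ^ 3 * R ^ (4 - k) := by
        gcongr
        · norm_num
        · omega
      _ = 27 * R ^ (4 - k) := by norm_num
  have h5 : a ^ (k - 1) ≤ a ^ 3 := pow_le_pow_right₀ ha (by omega)
  have h6 : R ^ 3 = R ^ (k - 1) * R ^ (4 - k) := by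
    rw [← pow_add]; congr 1; omega
  calc (2 : ℝ) ^ 4 * ((((k : ℝ) * (2 * d) + 1) ^ k) ^ k * (2 * R + 1) ^ (4 - k))
      ≤ 2 ^ 4 * ((9 ^ 16 * (d * (a * R) ^ (k - 1))) * (27 * R ^ (4 - k))) := by
        gcongr
        exact h2.trans (by gcongr)
    _ = 16 * (9 ^ 16 * 27 * a ^ (k - 1)) * (d * R ^ 3) := by
        rw [h6, mul_pow]; ring
    _ ≤ _ := by gcongr

open MvPolynomial in
theorem card_cubes_le {p : MvPolynomial (Fin 4) ℝ} {d R : ℕ} {a : ℝ} (hd : p.totalDegree ≤ d)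
    (hd1 : 1 ≤ d) (hR : 1 ≤ R) (ha : 1 ≤ a) (hdR : (d : ℝ) ^ 5 ≤ a * R)
    (hp : ∀ n : Fin 4 → ℤ, (∀ i, n i ∈ Finset.Icc (-R : ℤ) R) → eval (fun i => (n i : ℝ)) p ≠ 0)
    (M : Finset (Fin 4 → ℤ)) (hM : ∀ m ∈ M, ∀ i, m i ∈ Finset.Ico (-R : ℤ) R)
    (hz : ∀ m ∈ M, ∃ z : Fin 4 → ℝ, (∀ i, (m i : ℝ) ≤ z i ∧ z i ≤ m i + 1) ∧ eval z p = 0) :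
    (M.card : ℝ) ≤ 16 * (16 * (9 ^ 16 * 27 * a ^ 3)) * (d * (R : ℝ) ^ 3) := by
  have h := card_cubes_le_sum p d hd R hp M hM hz
  have hR' : (1 : ℝ) ≤ R := by exact_mod_cast hR
  have hd' : (1 : ℝ) ≤ d := by exact_mod_cast hd1
  have hterm : ∀ J : Finset (Fin 4), J.Nonempty →
      (((2 ^ Fintype.card (Fin 4) * (((J.card * (2 * d) + 1) ^ J.card) ^ J.card *
        (2 * R + 1) ^ (Fintype.card (Fin 4) - J.card)) : ℕ)) : ℝ) ≤
        16 * (9 ^ 16 * 27 * a ^ 3) * (d * (R : ℝ) ^ 3) := by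
    intro J hJ
    push_cast
    rw [Fintype.card_fin]
    exact faceCount_le hJ.card_pos (by simpa using Finset.card_le_univ J) hd' hR' ha hdR
  have hcard : ((Finset.univ.filter fun J : Finset (Fin 4) => J.Nonempty).card : ℝ) ≤ 16 := by
    have := Finset.card_filter_le (Finset.univ : Finset (Finset (Fin 4))) fun J => J.Nonempty
    simp only [Finset.card_univ, Fintype.card_finset, Fintype.card_fin] at this
    exact_mod_cast this
  calc (M.card : ℝ) ≤ _ := Nat.cast_le.2 h
    _ = _ := Nat.cast_sum _ _
    _ ≤ ∑ J : Finset (Fin 4) with J.Nonempty,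
        16 * (9 ^ 16 * 27 * a ^ 3) * (d * (R : ℝ) ^ 3) :=
      Finset.sum_le_sum fun J hJ => hterm J (Finset.mem_filter.1 hJ).2
    _ = (Finset.univ.filter fun J : Finset (Fin 4) => J.Nonempty).card *
        (16 * (9 ^ 16 * 27 * a ^ 3) * (d * (R : ℝ) ^ 3)) := by
      rw [Finset.sum_const, nsmul_eq_mul]
    _ ≤ 16 * (16 * (9 ^ 16 * 27 * a ^ 3) * (d * (R : ℝ) ^ 3)) := by gcongr
    _ = _ := by ring

/-! ### Covering the neighbourhood by boxes -/

-- The grid has cells of sides `β / s i` and a generic offset `τ` keeping its vertices off the zero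
-- set. A point `β`-close to a zero `w` is at most one cell from the cell of `w` in each direction,
-- hence the tripled boxes.
open MvPolynomial in
theorem exists_cubes_cover (P : MvPolynomial (Fin 4) ℝ) (hP : 1 ≤ P.totalDegree) {β a : ℝ}
    (hβ : 0 < β) (s : Fin 4 → ℝ) (hs : ∀ i, 0 < s i) (ha : 1 ≤ a) (R : ℕ)
    (hR : 1 / (2 * β) + 3 ≤ R) (hda : (P.totalDegree : ℝ) ^ 5 ≤ a * R) :
    ∃ (M : Finset (Fin 4 → ℤ)) (τ : Fin 4 → ℝ),
      (M.card : ℝ) ≤ 16 * (16 * (9 ^ 16 * 27 * a ^ 3)) * (P.totalDegree * (R : ℝ) ^ 3) ∧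
      ∀ z w : Fin 4 → ℝ, eval w P = 0 → (∀ i, |s i * z i| ≤ 1 / 2) →
        (∀ i, |s i * z i - s i * w i| < β) →
        ∃ m ∈ M, ∀ i, z i ∈ Set.Icc (τ i + β / s i * (m i - 1)) (τ i + β / s i * (m i + 2)) := by
  classical
  have hP0 : P ≠ 0 := by
    rintro rfl
    simp at hP
  have hh : ∀ i, 0 < β / s i := fun i => div_pos hβ (hs i)
  have hshift : ∀ n : Fin 4 → ℤ,
      (aeval (fun i => X i + C (β / s i * n i)) P : MvPolynomial (Fin 4) ℝ) ≠ 0 := by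
    refine fun n h0 => hP0 (MvPolynomial.funext fun x => ?_)
    have := congrArg (eval fun i => x i - β / s i * n i) h0
    rw [eval_aeval_mvPolynomial] at this
    simpa using this
  obtain ⟨τ, hτ, hτP⟩ := exists_forall_eval_ne_zero
    (Fintype.piFinset fun _ : Fin 4 => Finset.Icc (-R : ℤ) R) _ (fun n _ => hshift n)
    (fun i => Set.Ioo 0 (β / s i)) fun i => Set.Ioo_infinite (hh i)
  let p : MvPolynomial (Fin 4) ℝ := aeval (fun i => C (τ i) + C (β / s i) * X i) P
  have hpe : ∀ y : Fin 4 → ℝ, eval y p = eval (fun i => τ i + β / s i * y i) P := by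
    intro y
    rw [eval_aeval_mvPolynomial]
    simp
  have hpd : p.totalDegree ≤ P.totalDegree := by
    refine totalDegree_aeval_le_of_le_one P _ fun i => (totalDegree_add _ _).trans ?_
    refine max_le (by rw [totalDegree_C]; exact Nat.zero_le _) ((totalDegree_mul _ _).trans ?_)
    rw [totalDegree_C, totalDegree_X]
  have hβ' : 0 < 1 / (2 * β) := by positivity
  have hR1 : 1 ≤ R := by
    have : (1 : ℝ) ≤ R := by linarith
    exact_mod_cast this
  let M : Finset (Fin 4 → ℤ) := (Fintype.piFinset fun _ => Finset.Ico (-R : ℤ) R).filter fun m =>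
    ∃ z : Fin 4 → ℝ, (∀ i, (m i : ℝ) ≤ z i ∧ z i ≤ m i + 1) ∧ eval z p = 0
  refine ⟨M, τ, card_cubes_le hpd hP hR1 ha hda (fun n hn => ?_) M
    (fun m hm i => Fintype.mem_piFinset.1 (Finset.mem_filter.1 hm).1 i)
    (fun m hm => (Finset.mem_filter.1 hm).2), ?_⟩
  · have := hτP n (Fintype.mem_piFinset.2 hn)
    rw [eval_aeval_mvPolynomial] at this
    rw [hpe]
    simpa using this
  · intro z w hw hz hzw
    let y : Fin 4 → ℝ := fun i => (w i - τ i) / (β / s i)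
    have hwy : ∀ i, w i = τ i + β / s i * y i := fun i => by
      simp only [y]
      rw [mul_div_cancel₀ _ (hh i).ne']
      ring
    have hsw : ∀ i, s i * w i = s i * τ i + β * y i := fun i => by
      rw [hwy i, mul_add, ← mul_assoc, mul_div_cancel₀ _ (hs i).ne']
    have hsτ : ∀ i, 0 < s i * τ i ∧ s i * τ i < β := fun i =>
      ⟨mul_pos (hs i) (hτ i).1, by have := (hτ i).2; rwa [lt_div_iff₀' (hs i)] at this⟩
    have hy : ∀ i, |y i| < R - 1 := by
      intro i
      have h1 := abs_le.1 (hz i)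
      have h2 := abs_lt.1 (hzw i)
      have h3 := hsτ i
      have h4 := hsw i
      -- One `β` comes from the distance between `z` and `w`, the other from the offset `τ`; the
      -- remaining unit leaves room for the floor.
      have h5 : 1 / 2 + 2 * β ≤ β * (R - 1) := by
        have : 1 / 2 + 2 * β = β * (1 / (2 * β) + 2) := by field_simp
        rw [this]
        exact mul_le_mul_of_nonneg_left (by linarith) hβ.le
      rw [abs_lt]
      constructor
      · refine lt_of_mul_lt_mul_left ?_ hβ.le
        linarith
      · refine lt_of_mul_lt_mul_left ?_ hβ.le
        linarith
    have hfl := fun i => Int.floor_le (y i)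
    have hfl' := fun i => Int.lt_floor_add_one (y i)
    refine ⟨fun i => ⌊y i⌋, Finset.mem_filter.2 ⟨Fintype.mem_piFinset.2 fun i => ?_, y,
      fun i => ⟨hfl i, (hfl' i).le⟩, ?_⟩, fun i => ?_⟩
    · have := abs_lt.1 (hy i)
      rw [Finset.mem_Ico, Int.le_floor, Int.floor_lt]
      push_cast
      constructor <;> linarith
    · rw [hpe, ← funext hwy]
      exact hw
    · have h2 := abs_lt.1 (hzw i)
      have h4 := hsw i
      have e : ∀ t : ℝ, s i * (τ i + β / s i * t) = s i * τ i + β * t := fun t => by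
        rw [mul_add, ← mul_assoc, mul_div_cancel₀ _ (hs i).ne']
      have h5 := mul_le_mul_of_nonneg_left (hfl i) hβ.le
      have h6 := mul_le_mul_of_nonneg_left (hfl' i).le hβ.le
      constructor
      · refine le_of_mul_le_mul_left ?_ (hs i)
        rw [e]
        linarith
      · refine le_of_mul_le_mul_left ?_ (hs i)
        rw [e]
        linarith

theorem volume_euclideanBox {ι : Type*} [Fintype ι] (a b : ι → ℝ) :
    volume {z : EuclideanSpace ℝ ι | ∀ i, z i ∈ Set.Icc (a i) (b i)} =
      ∏ i, ENNReal.ofReal (b i - a i) := by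
  have h := (PiLp.volume_preserving_ofLp ι).measure_preimage
    (s := Set.pi Set.univ fun i => Set.Icc (a i) (b i))
    (MeasurableSet.univ_pi fun _ => measurableSet_Icc).nullMeasurableSet
  rw [volume_pi_pi] at h
  simp only [Real.volume_Icc] at h
  rw [← h]
  congr 1
  ext z
  simp [Pi.le_def, forall_and]

/-! ### Volumes in the anisotropic cylinder -/

namespace Shell

/-- The dilation factors of `scaling`. -/
noncomputable def scale (lam : ℝ) : Fin 4 → ℝ :=
  ![lam ^ (3 / 2 : ℝ), lam ^ (1 / 2 : ℝ), lam ^ (1 / 2 : ℝ), lam ^ (1 / 2 : ℝ)]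

theorem scale_pos {lam : ℝ} (hl : 0 < lam) (i : Fin 4) : 0 < scale lam i := by
  fin_cases i <;> simp [scale] <;> positivity

theorem scaling_apply (lam : ℝ) (z : SpaceTime) (i : Fin 4) :
    scaling lam z i = scale lam i * z i := by
  fin_cases i <;> simp [scaling, scale]

theorem norm_spacePart_sq (z : SpaceTime) :
    ‖spacePart z‖ ^ 2 = z 1 ^ 2 + z 2 ^ 2 + z 3 ^ 2 := by
  simp [spacePart, EuclideanSpace.norm_sq_eq, Fin.sum_univ_three]

theorem mem_cylinder_iff {lam : ℝ} (hl : 0 < lam) (z : SpaceTime) :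
    z ∈ cylinder lam ↔ |scale lam 0 * z 0| ≤ 1 / 2 ∧
      (scale lam 1 * z 1) ^ 2 + (scale lam 2 * z 2) ^ 2 + (scale lam 3 * z 3) ^ 2 ≤ 1 / 4 := by
  have h0 : 0 < lam ^ (3 / 2 : ℝ) := by positivity
  have h1 : 0 < lam ^ (1 / 2 : ℝ) := by positivity
  have e : ‖spacePart z‖ ≤ 1 / 2 * (lam ^ (1 / 2 : ℝ))⁻¹ ↔
      (lam ^ (1 / 2 : ℝ) * ‖spacePart z‖) ^ 2 ≤ (1 / 2) ^ 2 := by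
    rw [← div_eq_mul_inv, le_div_iff₀' h1, sq_le_sq₀ (by positivity) (by norm_num)]
  simp only [cylinder, Set.mem_ofPred_eq, Real.rpow_neg hl.le]
  rw [e, mul_pow, norm_spacePart_sq, ← div_eq_mul_inv, le_div_iff₀' h0]
  simp only [scale, Matrix.cons_val, abs_mul, abs_of_pos h0, mul_pow, mul_add]
  norm_num

theorem abs_scale_mul_le_of_mem_cylinder {lam : ℝ} (hl : 0 < lam) {z : SpaceTime}
    (hz : z ∈ cylinder lam) (i : Fin 4) : |scale lam i * z i| ≤ 1 / 2 := by
  obtain ⟨h0, h⟩ := (mem_cylinder_iff hl z).1 hz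
  have h1 := sq_nonneg (scale lam 1 * z 1)
  have h2 := sq_nonneg (scale lam 2 * z 2)
  have h3 := sq_nonneg (scale lam 3 * z 3)
  fin_cases i
  · exact h0
  all_goals
    refine abs_le_of_sq_le_sq ?_ (by norm_num)
    simp only [Fin.mk_one, Fin.reduceFinMk]
    norm_num
    linarith

theorem le_volume_cylinder {lam : ℝ} (hl : 0 < lam) :
    ENNReal.ofReal (1 / 8 * ∏ i, (scale lam i)⁻¹) ≤ volume (cylinder lam) := by
  have hs := scale_pos hl
  -- The box fits because `3 · (1/4)² ≤ 1/4`; its rescaled volume is `1 · (1/2)³ = 1/8`.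
  let r : Fin 4 → ℝ := ![1 / 2, 1 / 4, 1 / 4, 1 / 4]
  have hsub : {z : SpaceTime | ∀ i, z i ∈ Set.Icc (-(r i / scale lam i)) (r i / scale lam i)} ⊆
      cylinder lam := by
    intro z hz
    have h : ∀ i, |scale lam i * z i| ≤ r i := fun i => by
      rw [abs_mul, abs_of_pos (hs i), ← le_div_iff₀' (hs i)]
      exact abs_le.2 (hz i)
    refine (mem_cylinder_iff hl z).2 ⟨h 0, ?_⟩
    have h1 := sq_le_sq' (abs_le.1 (h 1)).1 (abs_le.1 (h 1)).2
    have h2 := sq_le_sq' (abs_le.1 (h 2)).1 (abs_le.1 (h 2)).2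
    have h3 := sq_le_sq' (abs_le.1 (h 3)).1 (abs_le.1 (h 3)).2
    simp only [r, Matrix.cons_val] at h1 h2 h3
    linarith
  refine le_of_eq_of_le ?_ (measure_mono hsub)
  rw [volume_euclideanBox, ← ENNReal.ofReal_prod_of_nonneg]
  · congr 1
    simp only [Fin.prod_univ_four, r, Matrix.cons_val, div_eq_mul_inv]
    ring
  · intro i _
    have : 0 ≤ r i := by fin_cases i <;> simp [r]
    have := div_nonneg this (hs i).le
    linarith

theorem exists_of_anisoDist_lt {lam β : ℝ} {z : SpaceTime} {Z : Set SpaceTime}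
    (h : anisoDist lam z Z < ENNReal.ofReal β) :
    ∃ w ∈ Z, ∀ i, |scale lam i * z i - scale lam i * w i| < β := by
  obtain ⟨_, ⟨w, hw, rfl⟩, hd⟩ := Metric.infEDist_lt_iff.1 h
  refine ⟨w, hw, fun i => ?_⟩
  rw [edist_dist, ENNReal.ofReal_lt_ofReal_iff_of_nonneg dist_nonneg, dist_eq_norm] at hd
  refine lt_of_le_of_lt ?_ hd
  have := PiLp.norm_apply_le (scaling lam z - scaling lam w) i
  rwa [PiLp.sub_apply, scaling_apply, scaling_apply, Real.norm_eq_abs] at this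

theorem volume_shell_le {lam β a : ℝ} (hl : 0 < lam) (hβ : 0 < β) (ha : 1 ≤ a)
    (P : MvPolynomial (Fin 4) ℝ) (hP : 1 ≤ P.totalDegree) (R : ℕ)
    (hR : 1 / (2 * β) + 3 ≤ R) (hda : (P.totalDegree : ℝ) ^ 5 ≤ a * R) :
    volume (shell lam β P) ≤
      ENNReal.ofReal (16 * (16 * (9 ^ 16 * 27 * a ^ 3)) * (P.totalDegree * (R : ℝ) ^ 3) *
        (81 * β ^ 4 * ∏ i, (scale lam i)⁻¹)) := by
  have hs := scale_pos hl
  obtain ⟨M, τ, hM, hcov⟩ := exists_cubes_cover P hP hβ (scale lam) hs ha R hR hda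
  have hsub : shell lam β P ⊆ ⋃ m ∈ M, {z : SpaceTime | ∀ i, z i ∈
      Set.Icc (τ i + β / scale lam i * (m i - 1)) (τ i + β / scale lam i * (m i + 2))} := by
    rintro z ⟨hz, hzd⟩
    obtain ⟨w, hw, hzw⟩ := exists_of_anisoDist_lt hzd
    obtain ⟨m, hm, h⟩ := hcov (fun i => z i) (fun i => w i) hw
      (abs_scale_mul_le_of_mem_cylinder hl hz) hzw
    exact Set.mem_biUnion hm h
  have hprod : 0 ≤ ∏ i, (scale lam i)⁻¹ := Finset.prod_nonneg fun i _ => (inv_pos.2 (hs i)).le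
  refine (measure_mono hsub).trans ((measure_biUnion_finset_le _ _).trans ?_)
  calc _ = ∑ _m ∈ M, ENNReal.ofReal (81 * β ^ 4 * ∏ i, (scale lam i)⁻¹) := by
        refine Finset.sum_congr rfl fun m _ => ?_
        rw [volume_euclideanBox, ← ENNReal.ofReal_prod_of_nonneg]
        · congr 1
          simp only [Fin.prod_univ_four, div_eq_mul_inv]
          ring
        · intro i _
          have := div_pos hβ (hs i)
          nlinarith
    _ = ENNReal.ofReal (M.card * (81 * β ^ 4 * ∏ i, (scale lam i)⁻¹)) := by
        rw [Finset.sum_const, nsmul_eq_mul, ENNReal.ofReal_mul (Nat.cast_nonneg _),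
          ENNReal.ofReal_natCast]
    _ ≤ _ := ENNReal.ofReal_le_ofReal (mul_le_mul_of_nonneg_right hM (by positivity))

end Shell

/-! ### Choice of parameters -/

theorem mainTheorem6 (c : ℝ) (hc : 0 < c) :
    ∃ C : ℝ, 0 < C ∧ ∀ lam : ℝ, 2 ≤ lam → ∀ P : MvPolynomial (Fin 4) ℝ,
      1 ≤ P.totalDegree → (P.totalDegree : ℝ) ≤ Shell.bigD lam ^ (1 / 4 : ℝ) →
      volume (Shell.cylinder lam ∩ Shell.shell lam (Shell.thickness c lam P) P) ≤
        ENNReal.ofReal (C * (Shell.bigD lam)⁻¹) * volume (Shell.cylinder lam) := by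
  set K : ℝ := 16 * (16 * (9 ^ 16 * 27 * (2 * c + 1) ^ 3)) with hK
  -- The cube bounds `βR`; `648 = 81 · 8` combines the tripled boxes with the cylinder's lower
  -- volume bound, and `c` comes from `dβ = c D⁻¹`.
  refine ⟨K * (1 / 2 + 4 * c) ^ 3 * 648 * c, by positivity, fun lam hlam P hP hPD => ?_⟩
  have hl : 0 < lam := by linarith
  set D := Shell.bigD lam with hD
  set d : ℝ := (P.totalDegree : ℝ) with hd
  have hd1 : 1 ≤ d := Nat.one_le_cast.2 hP
  have hD1 : 1 ≤ D := Real.one_le_rpow (by linarith) (by norm_num)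
  have hdD : d ^ 4 ≤ D := by
    calc d ^ 4 ≤ (D ^ (1 / 4 : ℝ)) ^ 4 := by gcongr
      _ = D := by
        rw [← Real.rpow_natCast, ← Real.rpow_mul (by positivity)]
        norm_num
  set β := Shell.thickness c lam P with hβ
  have hβe : β = c * D⁻¹ / d := rfl
  have hβ0 : 0 < β := by rw [hβe]; positivity
  have hβc : β ≤ c := by
    rw [hβe, div_le_iff₀ (by positivity), ← div_eq_mul_inv, div_le_iff₀ (by positivity)]
    nlinarith [mul_le_mul hd1 hD1 zero_le_one (by positivity)]
  have hβD : 1 / (2 * β) = d * D / (2 * c) := by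
    rw [hβe]; field_simp
  set R := ⌈1 / (2 * β)⌉₊ + 3 with hR
  have hR1 : 1 / (2 * β) + 3 ≤ R := by
    rw [hR]; push_cast
    linarith [Nat.le_ceil (1 / (2 * β))]
  have hR2 : (R : ℝ) ≤ 1 / (2 * β) + 4 := by
    rw [hR]; push_cast
    linarith [Nat.ceil_lt_add_one (show 0 ≤ 1 / (2 * β) by positivity)]
  have hβR : β * R ≤ 1 / 2 + 4 * c := by
    calc β * R ≤ β * (1 / (2 * β) + 4) := by gcongr
      _ = 1 / 2 + 4 * β := by field_simp
      _ ≤ _ := by linarith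
  have hda : d ^ 5 ≤ (2 * c + 1) * R := by
    calc d ^ 5 = d * d ^ 4 := by ring
      _ ≤ d * D := by gcongr
      _ = 2 * c * (1 / (2 * β)) := by rw [hβD]; field_simp
      _ ≤ (2 * c + 1) * R := by gcongr <;> linarith
  have hs := Shell.scale_pos hl
  have hprod : 0 ≤ ∏ i, (Shell.scale lam i)⁻¹ :=
    Finset.prod_nonneg fun i _ => (inv_pos.2 (hs i)).le
  have hdβ : d * β = c * D⁻¹ := by rw [hβe]; field_simp
  refine (measure_mono Set.inter_subset_right).trans
    ((Shell.volume_shell_le hl hβ0 (by linarith) P hP R hR1 hda).trans ?_)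
  refine le_trans ?_ (mul_le_mul_right (Shell.le_volume_cylinder hl) _)
  rw [← ENNReal.ofReal_mul (by positivity)]
  refine ENNReal.ofReal_le_ofReal ?_
  calc K * (d * (R : ℝ) ^ 3) * (81 * β ^ 4 * ∏ i, (Shell.scale lam i)⁻¹)
      = K * (β * R) ^ 3 * 81 * (d * β) * ∏ i, (Shell.scale lam i)⁻¹ := by ring
    _ ≤ K * (1 / 2 + 4 * c) ^ 3 * 81 * (d * β) * ∏ i, (Shell.scale lam i)⁻¹ := by gcongr
    _ = _ := by rw [hdβ]; ring
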